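/- **Theorem 2.2.** For a formal power series $\varphi(x)=\sum_{n\ge 0}\alpha_n x^n$ with complex coefficients and a complex polynomial $f$, write $\varphi(D)f=\sum_{n\ge 0}\alpha_n f^{(n)}$ (a finite sum). For a positive integer $p$ let $\exp(-D^p)$ denote $\varphi(D)$ for $\varphi(x)=\exp(-x^p)=\sum_{k\ge 0}\frac{(-1)^k}{k!}x^{pk}$, and let $M^d$ denote the monomial $M^d(x)=x^d$. Let $d$ and $p$ be positive integers with $p\ge 2$, and put $q=\lfloor d/p\rfloor$ and $r=d-pq$. 1. If $q=0$ (that is, $d<p$), then $\exp(-D^p)M^d=M^d$. 2. If $q\ge 1$, then $\exp(-D^p)M^d$ has exactly $q$ distinct positive (real) zeros; and if these are denoted by $\rho_1,\dots,\rho_q$, then $$\bigl(\exp(-D^p)M^d\bigr)(x)=x^r\prod_{j=1}^{q}\prod_{k=0}^{p-1}\bigl(x-e^{2k\pi i/p}\rho_j\bigr).$$ -/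

import Mathlib

open Polynomial

/-- The operator `φ(D) = ∑ αₙ Dⁿ` attached to a formal power series `φ(x) = ∑ αₙ xⁿ`, acting on
polynomials: `φ(D) f = ∑ₙ αₙ f⁽ⁿ⁾`. All terms with `n > deg f` vanish, so the sum is finite. -/
noncomputable def diffOp (φ : PowerSeries ℂ) (f : ℂ[X]) : ℂ[X] :=
  ∑ᶠ n : ℕ, C (PowerSeries.coeff n φ) * derivative^[n] f

/-- The sum defining `φ(D) f` has finite support (so that `finsum` is the genuine sum). -/
theorem diffOp_support_finite (φ : PowerSeries ℂ) (f : ℂ[X]) :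
    (Function.support fun n : ℕ => C (PowerSeries.coeff n φ) * derivative^[n] f).Finite := by
  refine (Set.finite_le_nat f.natDegree).subset fun n hn => ?_
  by_contra h
  apply hn
  have h' : f.natDegree < n := by simpa using h
  simp [iterate_derivative_eq_zero h']

/-- The formal power series `exp(-x^p)`, i.e. the exponential series with `-x^p` substituted for
its variable. The substitution is legitimate for `p ≥ 1`. -/
noncomputable def expNegPow (p : ℕ) : PowerSeries ℂ :=
  (PowerSeries.exp ℂ).subst (-(PowerSeries.X ^ p) : PowerSeries ℂ)

/-- For `p ≥ 1` the series `-x^p` may be substituted into any power series. -/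
theorem hasSubst_neg_X_pow {p : ℕ} (hp : 1 ≤ p) :
    PowerSeries.HasSubst (-(PowerSeries.X ^ p) : PowerSeries ℂ) := by
  apply PowerSeries.HasSubst.of_constantCoeff_zero'
  simp [Nat.one_le_iff_ne_zero.mp hp]

/-- The polynomial `exp(-D^p) M^d`, where `M^d(x) = x^d`. -/
noncomputable def expNegDPow (p d : ℕ) : ℂ[X] :=
  diffOp (expNegPow p) (X ^ d)

/-- The set of positive (real) zeros of a complex polynomial. -/
def positiveZeros (f : ℂ[X]) : Set ℝ :=
  {x : ℝ | 0 < x ∧ f.eval (x : ℂ) = 0}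

/-! Write d = pq + r. Then exp(-D^p) x^d = x^r G(x^p) with G monic of degree q
(`expNegDPow_eq_expand`), so the point is that G has q distinct positive zeros; p-th roots of unity
then give the product formula. Splitting the falling factorial (d)_{pk} by residues mod p and
substituting y = p^p/z turns G, up to a power of y, into (1 - z)^q with the coefficient of z^k
multiplied by (b_i)_k for the p - 1 numbers b_i = (d - i)/p, i ≠ r (`eval_reducedPoly`). For b > q -
1, multiplying coefficients by (b)_k turns a degree q polynomial with positive zeros, possibly
repeated, into one with q distinct positive zeros. After reversal, each linear factor X - l acts by
h ↦ βh + xh' - lxh = x^(1-β) e^(lx) (x^β e^(-lx) h)', and Rolle's theorem on (0, ∞) gains one zero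
per factor (`exists_positive_roots_step`). -/

/-! ### Rolle's theorem for x^β e^(-lx) h(x). -/

open Filter Topology in
/-- Rolle's theorem on a half-line `(a, ∞)` for a function vanishing at both ends. -/
theorem exists_deriv_zero_Ioi {f f' : ℝ → ℝ} {a : ℝ} (hfc : ContinuousWithinAt f (Set.Ioi a) a)
    (hfa : f a = 0) (hft : Tendsto f atTop (𝓝 0))
    (hff' : ∀ x, a < x → HasDerivAt f (f' x) x) : ∃ c, a < c ∧ f' c = 0 := by
  -- The map u ↦ a - 1 + 1/u carries (0, 1) onto (a, ∞), reversing the ends, which reduces to a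
  -- bounded interval.
  have hpos : ∀ u ∈ Set.Ioo (0 : ℝ) 1, a < a - 1 + u⁻¹ := fun u hu => by
    have := (one_lt_inv₀ hu.1).2 hu.2
    linarith
  have htop : Tendsto (fun u : ℝ => a - 1 + u⁻¹) (𝓝[>] 0) atTop :=
    tendsto_atTop_add_const_left _ _ tendsto_inv_nhdsGT_zero
  have hbot : Tendsto (fun u : ℝ => a - 1 + u⁻¹) (𝓝[<] 1) (𝓝[>] a) := by
    refine tendsto_nhdsWithin_iff.2 ⟨?_, ?_⟩
    · have h : ContinuousAt (fun u : ℝ => a - 1 + u⁻¹) 1 := by fun_prop (disch := norm_num)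
      have h2 := h.tendsto.mono_left (nhdsWithin_le_nhds (s := Set.Iio 1))
      simpa using h2
    · filter_upwards [Ioo_mem_nhdsLT (zero_lt_one (α := ℝ))] with u hu using hpos u hu
  have hd : ∀ u ∈ Set.Ioo (0 : ℝ) 1, HasDerivAt (fun u : ℝ => f (a - 1 + u⁻¹))
      (f' (a - 1 + u⁻¹) * (-(u ^ 2)⁻¹)) u := fun u hu =>
    (hff' _ (hpos u hu)).comp u ((hasDerivAt_inv hu.1.ne').const_add (a - 1))
  have hfc' : Tendsto f (𝓝[>] a) (𝓝 0) := hfa ▸ hfc.tendsto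
  obtain ⟨u, hu, h0⟩ := exists_hasDerivAt_eq_zero' zero_lt_one (hft.comp htop)
    (hfc'.comp hbot) hd
  refine ⟨_, hpos u hu, (mul_eq_zero.1 h0).resolve_right ?_⟩
  have := hu.1.ne'
  simp [this]

open Filter Topology in
theorem tendsto_rpow_mul_exp_mul_eval (h : ℝ[X]) (β : ℝ) {l : ℝ} (hl : 0 < l) :
    Tendsto (fun x : ℝ => x ^ β * Real.exp (-l * x) * h.eval x) atTop (𝓝 0) := by
  have key : ∀ n : ℕ, Tendsto (fun x : ℝ => h.coeff n * (x ^ (β + n) * Real.exp (-l * x)))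
      atTop (𝓝 0) := fun n => by
    simpa using (tendsto_rpow_mul_exp_neg_mul_atTop_nhds_zero (β + n) l hl).const_mul (h.coeff n)
  have hs := tendsto_finsetSum (Finset.range (h.natDegree + 1)) fun n _ => key n
  rw [Finset.sum_const_zero] at hs
  refine hs.congr' ?_
  filter_upwards [eventually_gt_atTop 0] with x hx
  rw [eval_eq_sum_range, Finset.mul_sum]
  refine Finset.sum_congr rfl fun n _ => ?_
  rw [Real.rpow_add hx, Real.rpow_natCast]
  ring

theorem hasDerivAt_rpow_mul_exp_mul_eval (h : ℝ[X]) (β l : ℝ) {x : ℝ} (hx : 0 < x) :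
    HasDerivAt (fun x : ℝ => x ^ β * Real.exp (-l * x) * h.eval x)
      (x ^ (β - 1) * Real.exp (-l * x) *
        (C β * h + X * derivative h - C l * X * h).eval x) x := by
  have h1 : HasDerivAt (fun x : ℝ => x ^ β) (β * x ^ (β - 1)) x :=
    Real.hasDerivAt_rpow_const (Or.inl hx.ne')
  have h2 : HasDerivAt (fun x : ℝ => Real.exp (-l * x)) (Real.exp (-l * x) * (-l * 1)) x :=
    ((hasDerivAt_id x).const_mul (-l)).exp
  refine ((h1.mul h2).mul (h.hasDerivAt x)).congr_deriv ?_
  have h3 : x ^ β = x ^ (β - 1) * x := by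
    rw [← Real.rpow_add_one hx.ne']; simp
  simp only [Pi.mul_apply, h3, eval_add, eval_sub, eval_mul, eval_C, eval_X]
  ring

/-- If `β, l > 0`, the polynomial `β h + x h' - l x h` has one more positive zero than `h`. -/
theorem exists_positive_roots_step (h : ℝ[X]) {β l : ℝ} (hβ : 0 < β) (hl : 0 < l)
    (S : Finset ℝ) (hS : ∀ x ∈ S, 0 < x ∧ h.eval x = 0) :
    ∃ T : Finset ℝ, T.card = S.card + 1 ∧
      ∀ x ∈ T, 0 < x ∧ (C β * h + X * derivative h - C l * X * h).eval x = 0 := by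
  set k : ℝ[X] := C β * h + X * derivative h - C l * X * h with hk
  -- For k = 0 any positive points serve; this case is separate because `roots` of the zero
  -- polynomial is empty.
  by_cases hk0 : k = 0
  · refine ⟨(Finset.range (S.card + 1)).image fun n : ℕ => (n : ℝ) + 1, ?_, fun x hx => ?_⟩
    · rw [Finset.card_image_of_injective _ fun a b hab => by simpa using hab, Finset.card_range]
    · obtain ⟨n, -, rfl⟩ := Finset.mem_image.1 hx
      exact ⟨by positivity, by simp [hk0]⟩
  set f : ℝ → ℝ := fun x => x ^ β * Real.exp (-l * x) * h.eval x with hf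
  have hfc : Continuous f := by
    have : Continuous fun x : ℝ => x ^ β := Real.continuous_rpow_const hβ.le
    fun_prop
  have hfd : ∀ x, 0 < x → HasDerivAt f (x ^ (β - 1) * Real.exp (-l * x) * k.eval x) x :=
    fun x hx => hasDerivAt_rpow_mul_exp_mul_eval h β l hx
  have hz : ∀ x, 0 < x → x ^ (β - 1) * Real.exp (-l * x) * k.eval x = 0 → k.eval x = 0 :=
    fun x hx h0 => (mul_eq_zero.1 h0).resolve_left
      (mul_pos (Real.rpow_pos_of_pos hx _) (Real.exp_pos _)).ne'
  -- Since β > 0, the function f also vanishes at 0.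
  set S' := insert 0 S with hS'
  have hS'0 : ∀ x ∈ S', 0 ≤ x ∧ f x = 0 := by
    intro x hx
    rcases Finset.mem_insert.1 hx with rfl | hx
    · exact ⟨le_rfl, by simp [hf, Real.zero_rpow hβ.ne']⟩
    · exact ⟨(hS x hx).1.le, by simp [hf, (hS x hx).2]⟩
  have hS'card : S'.card = S.card + 1 :=
    Finset.card_insert_of_notMem fun h0 => lt_irrefl _ (hS 0 h0).1
  have hne : S'.Nonempty := Finset.insert_nonempty _ _
  set M := S'.max' hne
  have hM : M ∈ S' := S'.max'_mem hne
  set t := k.roots.toFinset.filter fun x => 0 < x with ht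
  have hmem : ∀ x, x ∈ t ↔ 0 < x ∧ k.eval x = 0 := fun x => by
    simp [ht, hk0, and_comm]
  obtain ⟨z, hMz, hz0⟩ := exists_deriv_zero_Ioi (a := M) hfc.continuousWithinAt (hS'0 M hM).2
    (tendsto_rpow_mul_exp_mul_eval h β hl) fun x hx => hfd x ((hS'0 M hM).1.trans_lt hx)
  have hzpos := (hS'0 M hM).1.trans_lt hMz
  -- Zeros of k between consecutive points of S' number at least |S|; z, beyond M, is the extra one.
  have hcard : S'.card ≤ (t.filter fun x => x < M).card + 1 := by
    refine Finset.card_le_of_interleaved fun x hx y hy hxy _ => ?_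
    obtain ⟨c, hc, hc0⟩ := exists_hasDerivAt_eq_zero hxy hfc.continuousOn
      ((hS'0 x hx).2.trans (hS'0 y hy).2.symm) fun c hc => hfd c ((hS'0 x hx).1.trans_lt hc.1)
    have hcpos := (hS'0 x hx).1.trans_lt hc.1
    exact ⟨c, Finset.mem_filter.2 ⟨(hmem c).2 ⟨hcpos, hz c hcpos hc0⟩,
      hc.2.trans_le (S'.le_max' y hy)⟩, hc⟩
  have hlt : (t.filter fun x => x < M).card < t.card :=
    Finset.card_lt_card (Finset.filter_ssubset.2
      ⟨z, (hmem z).2 ⟨hzpos, hz z hzpos hz0⟩, not_lt.2 hMz.le⟩)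
  obtain ⟨T, hTt, hT⟩ := Finset.exists_subset_card_eq (s := t) (n := S.card + 1) (by omega)
  exact ⟨T, hT, fun x hx => (hmem x).1 (hTt hx)⟩

/-! ### Multiplying coefficients by falling factorials. -/

/-- `∑ aᵢ xⁱ ↦ ∑ aᵢ b(b-1)⋯(b-i+1) x^(m-i)`, the sums being over `i ≤ m`. -/
noncomputable def reverseFallingMul (b : ℝ) (m : ℕ) (f : ℝ[X]) : ℝ[X] :=
  ∑ i ∈ Finset.range (m + 1), C (f.coeff i * (descPochhammer ℝ i).eval b) * X ^ (m - i)

/-- `∑ aᵢ xⁱ ↦ ∑ aᵢ b(b-1)⋯(b-i+1) xⁱ`, the sums being over `i ≤ m`. -/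
noncomputable def fallingMul (b : ℝ) (m : ℕ) (f : ℝ[X]) : ℝ[X] :=
  ∑ i ∈ Finset.range (m + 1), C (f.coeff i * (descPochhammer ℝ i).eval b) * X ^ i

/-- Multiplication by X moves a_i to index i + 1, adding the factor b - i = (b - m) + (m - i), and m
- i is the eigenvalue of x d/dx on x^(m-i). -/
theorem reverseFallingMul_mul_X_sub_C (b l : ℝ) {m : ℕ} {f : ℝ[X]} (hf : f.natDegree ≤ m) :
    reverseFallingMul b (m + 1) (f * (X - C l)) =
      C (b - m) * reverseFallingMul b m f + X * derivative (reverseFallingMul b m f) -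
        C l * X * reverseFallingMul b m f := by
  have h1 : reverseFallingMul b (m + 1) (f * X) =
      C (b - m) * reverseFallingMul b m f + X * derivative (reverseFallingMul b m f) := by
    unfold reverseFallingMul
    rw [Finset.sum_range_succ', derivative_sum, Finset.mul_sum, Finset.mul_sum,
      ← Finset.sum_add_distrib]
    simp only [mul_coeff_zero, coeff_X_zero, mul_zero, zero_mul, map_zero, add_zero]
    refine Finset.sum_congr rfl fun i hi => ?_
    have him : i ≤ m := Nat.lt_succ_iff.1 (Finset.mem_range.1 hi)
    have hX : X * derivative (X ^ (m - i) : ℝ[X]) = C ((m : ℝ) - i) * X ^ (m - i) := by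
      rw [derivative_X_pow, ← Nat.cast_sub him]
      rcases Nat.eq_zero_or_pos (m - i) with h0 | h0
      · simp [h0]
      · rw [mul_left_comm, mul_pow_sub_one h0.ne']
    rw [derivative_C_mul, mul_left_comm X, hX, coeff_mul_X, descPochhammer_succ_eval,
      Nat.add_sub_add_right]
    simp only [map_mul, map_sub]
    ring
  have h2 : reverseFallingMul b (m + 1) (f * C l) = C l * X * reverseFallingMul b m f := by
    unfold reverseFallingMul
    rw [Finset.sum_range_succ, coeff_mul_C, coeff_eq_zero_of_natDegree_lt (Nat.lt_succ_of_le hf),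
      Finset.mul_sum]
    simp only [zero_mul, map_zero, add_zero]
    refine Finset.sum_congr rfl fun i hi => ?_
    have him : i ≤ m := Nat.lt_succ_iff.1 (Finset.mem_range.1 hi)
    rw [coeff_mul_C, Nat.succ_sub him, pow_succ]
    simp only [map_mul]
    ring
  rw [← h1, ← h2]
  simp only [reverseFallingMul, mul_sub, coeff_sub, sub_mul, map_sub, Finset.sum_sub_distrib]

/-- The factor added after m others has β = b - m with m ≤ `s.card` - 1, so the bound on b keeps
every β positive. -/
theorem exists_roots_reverseFallingMul (b : ℝ) (s : Multiset ℝ) (hs : ∀ l ∈ s, 0 < l)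
    (hb : (s.card : ℝ) - 1 < b) :
    ∃ S : Finset ℝ, S.card = s.card ∧ ∀ x ∈ S, 0 < x ∧
      (reverseFallingMul b s.card (s.map fun l => X - C l).prod).eval x = 0 := by
  induction s using Multiset.induction_on with
  | empty => exact ⟨∅, by simp, by simp⟩
  | cons l s ih =>
    rw [Multiset.card_cons, Nat.cast_succ] at hb
    obtain ⟨S, hS, hSr⟩ := ih (fun x hx => hs x (Multiset.mem_cons_of_mem hx)) (by linarith)
    obtain ⟨T, hT, hTr⟩ := exists_positive_roots_step _ (β := b - s.card) (by linarith)
      (hs l (Multiset.mem_cons_self l s)) S hSr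
    refine ⟨T, by rw [hT, hS, Multiset.card_cons], ?_⟩
    rwa [Multiset.card_cons, Multiset.map_cons, Multiset.prod_cons, mul_comm (X - C l),
      reverseFallingMul_mul_X_sub_C b l (natDegree_multiset_prod_X_sub_C_eq_card s).le]

theorem coeff_fallingMul (b : ℝ) (m : ℕ) (f : ℝ[X]) (k : ℕ) :
    (fallingMul b m f).coeff k = if k ≤ m then f.coeff k * (descPochhammer ℝ k).eval b else 0 := by
  simp only [fallingMul, finsetSum_coeff, coeff_C_mul, coeff_X_pow, mul_ite, mul_one, mul_zero,
    Finset.sum_ite_eq, Finset.mem_range, Nat.lt_succ_iff]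

theorem eval_fallingMul_inv (b : ℝ) (m : ℕ) (f : ℝ[X]) {x : ℝ} (hx : x ≠ 0) :
    x ^ m * (fallingMul b m f).eval x⁻¹ = (reverseFallingMul b m f).eval x := by
  simp only [fallingMul, reverseFallingMul, eval_finsetSum, eval_mul, eval_C, eval_pow, eval_X,
    Finset.mul_sum]
  refine Finset.sum_congr rfl fun i hi => ?_
  rw [pow_sub₀ x hx (Nat.lt_succ_iff.1 (Finset.mem_range.1 hi)), inv_pow]
  ring

/-- `f` is a nonzero constant times a product of `q` factors `X - l` with `l > 0`. -/
def SplitsPositively (f : ℝ[X]) (q : ℕ) : Prop :=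
  ∃ a : ℝ, a ≠ 0 ∧ ∃ s : Multiset ℝ, s.card = q ∧ (∀ l ∈ s, 0 < l) ∧
    f = C a * (s.map fun l => X - C l).prod

/-- `f` has at least `q` distinct positive zeros. -/
def HasPositiveRoots (f : ℝ[X]) (q : ℕ) : Prop :=
  ∃ S : Finset ℝ, S.card = q ∧ ∀ x ∈ S, 0 < x ∧ f.eval x = 0

theorem SplitsPositively.hasPositiveRoots_fallingMul {f : ℝ[X]} {q : ℕ}
    (hf : SplitsPositively f q) {b : ℝ} (hb : (q : ℝ) - 1 < b) :
    HasPositiveRoots (fallingMul b q f) q := by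
  obtain ⟨a, -, s, rfl, hs, rfl⟩ := hf
  obtain ⟨S, hS, hSr⟩ := exists_roots_reverseFallingMul b s hs hb
  refine ⟨S.image (·⁻¹), by rw [Finset.card_image_of_injective _ inv_injective, hS], fun y hy => ?_⟩
  obtain ⟨x, hx, rfl⟩ := Finset.mem_image.1 hy
  refine ⟨inv_pos.2 (hSr x hx).1, ?_⟩
  have h := (hSr x hx).2
  rw [← eval_fallingMul_inv _ _ _ (hSr x hx).1.ne'] at h
  have h' := (mul_eq_zero.1 h).resolve_left (pow_ne_zero _ (hSr x hx).1.ne')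
  have : fallingMul b s.card (C a * (s.map fun l => X - C l).prod) =
      C a * fallingMul b s.card (s.map fun l => X - C l).prod := by
    ext k
    simp only [coeff_fallingMul, coeff_C_mul, mul_ite, mul_zero, mul_assoc]
  rw [this, eval_mul, h', mul_zero]

theorem roots_eq_val_of_card {K : Type*} [Field K] {f : K[X]} {q : ℕ} (h0 : f ≠ 0)
    (hdeg : f.natDegree ≤ q) {S : Finset K} (hS : S.card = q) (hr : ∀ x ∈ S, f.eval x = 0) :
    f.roots = S.val ∧ f = C f.leadingCoeff * ∏ x ∈ S, (X - C x) := by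
  have hle : S.val ≤ f.roots := (Multiset.le_iff_subset S.nodup).2 fun x hx =>
    (mem_roots h0).2 (hr x hx)
  have hroots : f.roots = S.val := by
    refine (Multiset.eq_of_le_of_card_le hle ?_).symm
    exact (card_roots' f).trans (hdeg.trans hS.ge)
  refine ⟨hroots, ?_⟩
  have hc : f.roots.card = f.natDegree := by
    refine le_antisymm (card_roots' f) (hdeg.trans ?_)
    rw [hroots]; exact hS.ge
  rw [Finset.prod_eq_multiset_prod, ← hroots, C_leadingCoeff_mul_prod_multiset_X_sub_C hc]

theorem HasPositiveRoots.splitsPositively {f : ℝ[X]} {q : ℕ} (hf : HasPositiveRoots f q)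
    (h0 : f ≠ 0) (hdeg : f.natDegree ≤ q) : SplitsPositively f q := by
  obtain ⟨S, hS, hr⟩ := hf
  exact ⟨f.leadingCoeff, leadingCoeff_ne_zero.2 h0, S.val, hS, fun l hl => (hr l hl).1,
    (roots_eq_val_of_card h0 hdeg hS fun x hx => (hr x hx).2).2⟩

/-! ### Repeated multiplication starting from (1 - x)^q. -/

/-- `∑ₖ (-1)ᵏ (q choose k) ∏_{i ∈ T} (bᵢ(bᵢ-1)⋯(bᵢ-k+1)) xᵏ`. -/
noncomputable def binomialFalling (q : ℕ) (b : ℕ → ℝ) (T : Finset ℕ) : ℝ[X] :=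
  ∑ k ∈ Finset.range (q + 1),
    C ((-1) ^ k * (q.choose k : ℝ) * ∏ i ∈ T, (descPochhammer ℝ k).eval (b i)) * X ^ k

theorem coeff_binomialFalling (q : ℕ) (b : ℕ → ℝ) (T : Finset ℕ) (k : ℕ) :
    (binomialFalling q b T).coeff k =
      if k ≤ q then (-1) ^ k * (q.choose k : ℝ) * ∏ i ∈ T, (descPochhammer ℝ k).eval (b i)
      else 0 := by
  simp only [binomialFalling, finsetSum_coeff, coeff_C_mul, coeff_X_pow, mul_ite, mul_one, mul_zero,
    Finset.sum_ite_eq, Finset.mem_range, Nat.lt_succ_iff]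

theorem binomialFalling_ne_zero (q : ℕ) (b : ℕ → ℝ) (T : Finset ℕ) :
    binomialFalling q b T ≠ 0 := fun h => by
  have := coeff_binomialFalling q b T 0
  simp [h] at this

/-- The induction carries only splitting, because (1 - x)^q has a multiple zero; one multiplication
already makes the zeros distinct. -/
theorem binomialFalling_splits_and_roots (q : ℕ) (b : ℕ → ℝ) (T : Finset ℕ)
    (hb : ∀ i ∈ T, (q : ℝ) - 1 < b i) :
    SplitsPositively (binomialFalling q b T) q ∧
      (T.Nonempty → HasPositiveRoots (binomialFalling q b T) q) := by
  induction T using Finset.induction_on with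
  | empty =>
    refine ⟨⟨(-1) ^ q, by simp, Multiset.replicate q 1, by simp, fun l hl => ?_, ?_⟩, by simp⟩
    · rw [Multiset.eq_of_mem_replicate hl]; exact one_pos
    · rw [Multiset.map_replicate, Multiset.prod_replicate, map_pow, ← mul_pow]
      have : (C (-1) * (X - C 1) : ℝ[X]) = -X + 1 := by simp; ring
      rw [this, add_pow]
      refine Finset.sum_congr rfl fun k _ => ?_
      simp only [Finset.prod_empty, map_mul, map_pow, map_neg, map_one, map_natCast, one_pow,
        mul_one, neg_pow (X : ℝ[X])]
      ring
  | insert i T hi ih =>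
    have h1 := (ih fun j hj => hb j (Finset.mem_insert_of_mem hj)).1.hasPositiveRoots_fallingMul
      (hb i (Finset.mem_insert_self i T))
    have h2 : fallingMul (b i) q (binomialFalling q b T) = binomialFalling q b (insert i T) := by
      ext k
      rw [coeff_fallingMul, coeff_binomialFalling, coeff_binomialFalling, Finset.prod_insert hi]
      split_ifs
      · ring
      · rfl
    rw [h2] at h1
    refine ⟨h1.splitsPositively (binomialFalling_ne_zero _ _ _) ?_, fun _ => h1⟩
    refine natDegree_le_iff_coeff_eq_zero.2 fun k hk => ?_
    rw [coeff_binomialFalling, if_neg (not_le.2 hk)]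

/-! ### Reduction of exp(-D^p) x^d to G. -/

theorem coeff_expNegPow {p : ℕ} (hp : 1 ≤ p) (n : ℕ) :
    PowerSeries.coeff n (expNegPow p) =
      if p ∣ n then (-1) ^ (n / p) / ((n / p).factorial : ℂ) else 0 := by
  have hpow : ∀ k : ℕ, PowerSeries.coeff n ((-(PowerSeries.X ^ p) : PowerSeries ℂ) ^ k) =
      if n = p * k then (-1) ^ k else 0 := fun k => by
    rw [neg_pow, ← pow_mul, show ((-1) ^ k : PowerSeries ℂ) = PowerSeries.C ((-1) ^ k) by simp,
      PowerSeries.coeff_C_mul, PowerSeries.coeff_X_pow, mul_ite, mul_one, mul_zero]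
  rw [expNegPow, PowerSeries.coeff_subst' (hasSubst_neg_X_pow hp)]
  simp only [hpow, PowerSeries.coeff_exp]
  split_ifs with h
  · obtain ⟨m, rfl⟩ := h
    rw [Nat.mul_div_cancel_left m hp, finsum_eq_single _ m]
    · simp [div_eq_inv_mul]
    · intro k hk
      rw [if_neg fun h => hk (Nat.eq_of_mul_eq_mul_left hp h).symm, smul_zero]
  · refine finsum_eq_zero_of_forall_eq_zero fun k => ?_
    rw [if_neg fun hk => h ⟨k, hk⟩, smul_zero]

theorem expNegDPow_eq_sum {p q r : ℕ} (hp : 1 ≤ p) (hr : r < p) :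
    expNegDPow p (p * q + r) = ∑ k ∈ Finset.range (q + 1),
      C ((-1) ^ k / (k.factorial : ℂ) * ((p * q + r).descFactorial (p * k) : ℂ)) *
        X ^ (p * q + r - p * k) := by
  have hinj : Function.Injective fun k : ℕ => p * k := fun a b h => Nat.eq_of_mul_eq_mul_left hp h
  have hlt : ∀ k, p * k ≤ p * q + r → k ≤ q := fun k hk => by
    by_contra! h
    have := Nat.mul_le_mul_left p (Nat.succ_le_of_lt h)
    rw [Nat.mul_succ] at this
    omega
  rw [expNegDPow, diffOp, finsum_eq_sum_of_support_subset
    (s := (Finset.range (q + 1)).image fun k => p * k)]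
  · rw [Finset.sum_image fun a _ b _ h => hinj h]
    refine Finset.sum_congr rfl fun k _ => ?_
    rw [coeff_expNegPow hp, if_pos (dvd_mul_right p k), Nat.mul_div_cancel_left k hp,
      iterate_derivative_X_pow_eq_C_mul, ← mul_assoc, ← C_mul]
  · intro n hn
    rw [Function.mem_support, coeff_expNegPow hp, iterate_derivative_X_pow_eq_C_mul] at hn
    split_ifs at hn with h
    · obtain ⟨k, rfl⟩ := h
      refine Finset.mem_coe.2 (Finset.mem_image.2 ⟨k, Finset.mem_range.2 (Nat.lt_succ_of_le
        (hlt k ?_)), rfl⟩)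
      by_contra! hk
      exact hn (by simp [Nat.descFactorial_of_lt hk])
    · simp at hn

/-- The polynomial `G` with `exp(-D^p) M^d = x^r G(x^p)`, where `d = p * q + r` and `r < p`. -/
noncomputable def reducedPoly (p q r : ℕ) : ℝ[X] :=
  ∑ k ∈ Finset.range (q + 1),
    C ((-1) ^ k / (k.factorial : ℝ) * ((p * q + r).descFactorial (p * k) : ℝ)) * X ^ (q - k)

theorem expNegDPow_eq_expand {p q r : ℕ} (hp : 1 ≤ p) (hr : r < p) :
    expNegDPow p (p * q + r) =
      X ^ r * expand ℂ p ((reducedPoly p q r).map Complex.ofRealHom) := by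
  rw [expNegDPow_eq_sum hp hr, reducedPoly, Polynomial.map_sum, map_sum, Finset.mul_sum]
  refine Finset.sum_congr rfl fun k hk => ?_
  have hkq := Nat.mul_le_mul_left p (Nat.lt_succ_iff.1 (Finset.mem_range.1 hk))
  have hexp : p * q + r - p * k = r + p * (q - k) := by rw [Nat.mul_sub]; omega
  rw [hexp]
  have hc : Complex.ofRealHom
      ((-1) ^ k / (k.factorial : ℝ) * ((p * q + r).descFactorial (p * k) : ℝ)) =
      (-1) ^ k / (k.factorial : ℂ) * ((p * q + r).descFactorial (p * k) : ℂ) := by simp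
  rw [Polynomial.map_mul, map_C, hc, Polynomial.map_pow, map_X, map_mul (expand ℂ p), expand_C,
    map_pow (expand ℂ p), expand_X, pow_add, pow_mul]
  ring

theorem natDegree_reducedPoly_le (p q r : ℕ) : (reducedPoly p q r).natDegree ≤ q :=
  natDegree_sum_le_of_forall_le _ _ fun k _ =>
    (natDegree_C_mul_X_pow_le _ _).trans (Nat.sub_le q k)

theorem coeff_reducedPoly (p q r : ℕ) : (reducedPoly p q r).coeff q = 1 := by
  rw [reducedPoly, finsetSum_coeff, Finset.sum_eq_single 0]
  · simp
  · intro k hk hk0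
    have hkq := Finset.mem_range.1 hk
    rw [coeff_C_mul, coeff_X_pow, if_neg (by omega), mul_zero]
  · simp

theorem monic_reducedPoly (p q r : ℕ) : (reducedPoly p q r).Monic :=
  monic_of_natDegree_le_of_coeff_eq_one q (natDegree_reducedPoly_le p q r) (coeff_reducedPoly p q r)

/-! ### Zeros of G. -/

/-- Group the factors x - j, j < pk, by the residue i of j mod p and take p out of each. -/
theorem descPochhammer_eval_mul {p : ℕ} (hp : p ≠ 0) (x : ℝ) (k : ℕ) :
    (descPochhammer ℝ (p * k)).eval x =
      ((p : ℝ) ^ p) ^ k * ∏ i ∈ Finset.range p, (descPochhammer ℝ k).eval ((x - i) / p) := by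
  induction k with
  | zero => simp
  | succ k ih =>
    simp only [descPochhammer_succ_eval, Finset.prod_mul_distrib]
    have hp' : (p : ℝ) ≠ 0 := Nat.cast_ne_zero.2 hp
    have h1 : ∏ i ∈ Finset.range p, (x - (p * k + i : ℕ)) =
        (p : ℝ) ^ p * ∏ i ∈ Finset.range p, ((x - i) / p - k) := by
      rw [← Finset.card_range p, ← Finset.prod_const, Finset.card_range,
        ← Finset.prod_mul_distrib]
      refine Finset.prod_congr rfl fun i _ => ?_
      push_cast
      field_simp
      ring
    rw [descPochhammer_eval_eq_prod_range] at ih ⊢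
    rw [Nat.mul_succ, Finset.prod_range_add, ih, h1]
    ring

/-- Substituting `p^p / y` identifies the reduced polynomial with a binomial polynomial twisted by
falling factorials. -/
theorem eval_reducedPoly {p q r : ℕ} (hr : r < p) {y : ℝ} (hy : y ≠ 0) :
    (reducedPoly p q r).eval y = y ^ q *
      (binomialFalling q (fun i => ((p * q + r : ℕ) - i : ℝ) / p)
        ((Finset.range p).erase r)).eval ((p : ℝ) ^ p / y) := by
  have hp : p ≠ 0 := by omega
  have hp' : (p : ℝ) ≠ 0 := Nat.cast_ne_zero.2 hp
  simp only [reducedPoly, binomialFalling, eval_finsetSum, eval_mul, eval_C, eval_pow, eval_X,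
    Finset.mul_sum]
  refine Finset.sum_congr rfl fun k hk => ?_
  -- The residue i = r contributes (q)_k = k! (q choose k), whose k! cancels the one from the
  -- exponential series.
  have hq : (((p * q + r : ℕ) : ℝ) - r) / p = q := by
    push_cast; field_simp; ring
  rw [← descPochhammer_eval_eq_descFactorial ℝ, descPochhammer_eval_mul hp,
    ← Finset.mul_prod_erase _ _ (Finset.mem_range.2 hr), hq,
    descPochhammer_eval_eq_descFactorial ℝ, Nat.descFactorial_eq_factorial_mul_choose,
    pow_sub₀ y hy (Nat.lt_succ_iff.1 (Finset.mem_range.1 hk)), div_pow]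
  have hk0 : (k.factorial : ℝ) ≠ 0 := Nat.cast_ne_zero.2 k.factorial_ne_zero
  push_cast
  field_simp

theorem hasPositiveRoots_reducedPoly {p q r : ℕ} (hp : 2 ≤ p) (hr : r < p) :
    HasPositiveRoots (reducedPoly p q r) q := by
  have hp0 : (0 : ℝ) < p := by positivity
  have hc : (0 : ℝ) < (p : ℝ) ^ p := by positivity
  obtain ⟨S, hS, hSr⟩ := (binomialFalling_splits_and_roots q
    (fun i => ((p * q + r : ℕ) - i : ℝ) / p) ((Finset.range p).erase r) fun i hi => by
      -- The bound (d - i)/p > q - 1 amounts to r - i > -p.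
      have hip : (i : ℝ) < p := Nat.cast_lt.2 (Finset.mem_range.1 (Finset.mem_of_mem_erase hi))
      rw [lt_div_iff₀ hp0]
      push_cast
      -- As p ≥ 2, some residue other than r remains, so at least one multiplication occurs and the
      -- zeros are distinct.
      nlinarith [(Nat.cast_nonneg r : (0 : ℝ) ≤ r)]).2 (Finset.card_pos.1 (by
        rw [Finset.card_erase_of_mem (Finset.mem_range.2 hr), Finset.card_range]; omega))
  refine ⟨S.image fun z => (p : ℝ) ^ p / z, ?_, fun y hy => ?_⟩
  · rw [Finset.card_image_of_injOn, hS]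
    intro a ha b hb hab
    simpa [div_eq_mul_inv, hc.ne'] using hab
  · obtain ⟨z, hz, rfl⟩ := Finset.mem_image.1 hy
    have hz0 := (hSr z hz).1
    refine ⟨div_pos hc hz0, ?_⟩
    rw [eval_reducedPoly hr (div_pos hc hz0).ne', div_div_cancel₀ hc.ne', (hSr z hz).2, mul_zero]

/-! ### Back to the zeros of exp(-D^p) x^d. -/

theorem mem_positiveZeros_expNegDPow {p q r : ℕ} (hp : 1 ≤ p) (hr : r < p) (x : ℝ) :
    x ∈ positiveZeros (expNegDPow p (p * q + r)) ↔
      0 < x ∧ (reducedPoly p q r).eval (x ^ p) = 0 := by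
  refine and_congr_right fun hx => ?_
  have hx' : (x : ℂ) ^ r ≠ 0 := pow_ne_zero _ (Complex.ofReal_ne_zero.2 hx.ne')
  have : eval ((x : ℂ) ^ p) ((reducedPoly p q r).map Complex.ofRealHom) =
      ((reducedPoly p q r).eval (x ^ p) : ℝ) := by
    rw [← Complex.ofReal_pow]
    exact eval_map_apply Complex.ofRealHom (x ^ p)
  rw [expNegDPow_eq_expand hp hr, eval_mul, expand_eval, eval_pow, eval_X, mul_eq_zero,
    or_iff_right hx', this, Complex.ofReal_eq_zero]

theorem encard_positiveZeros_expNegDPow {p q r : ℕ} (hp : 2 ≤ p) (hr : r < p) :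
    (positiveZeros (expNegDPow p (p * q + r))).encard = q := by
  obtain ⟨S, hS, hSr⟩ := hasPositiveRoots_reducedPoly (q := q) hp hr
  have hroots := (roots_eq_val_of_card (monic_reducedPoly p q r).ne_zero
    (natDegree_reducedPoly_le p q r) hS fun x hx => (hSr x hx).2).1
  have hp0 : p ≠ 0 := by omega
  -- Taking p-th powers is a bijection from the positive zeros onto the zeros of G, all of which are
  -- positive.
  have himage : (fun x : ℝ => x ^ p) '' positiveZeros (expNegDPow p (p * q + r)) = S := by
    ext y
    simp only [Set.mem_image, mem_positiveZeros_expNegDPow (by omega : 1 ≤ p) hr, Finset.mem_coe]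
    constructor
    · rintro ⟨x, ⟨-, hx⟩, rfl⟩
      rw [← Finset.mem_val, ← hroots]
      exact (mem_roots (monic_reducedPoly p q r).ne_zero).2 hx
    · intro hy
      have h := Real.rpow_inv_natCast_pow (hSr y hy).1.le hp0
      exact ⟨y ^ (p : ℝ)⁻¹, ⟨Real.rpow_pos_of_pos (hSr y hy).1 _, by rw [h]; exact (hSr y hy).2⟩, h⟩
  have hinj : Set.InjOn (fun x : ℝ => x ^ p) (positiveZeros (expNegDPow p (p * q + r))) :=
    fun a ha b hb hab => (pow_left_inj₀ ha.1.le hb.1.le hp0).1 hab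
  rw [← hinj.encard_image, himage, Set.encard_coe_eq_coe_finsetCard, hS]

theorem prod_X_sub_C_exp_mul {p : ℕ} (hp : p ≠ 0) (z : ℂ) :
    ∏ k ∈ Finset.range p,
        (X - C (Complex.exp (2 * (k : ℂ) * (Real.pi : ℂ) * Complex.I / (p : ℂ)) * z)) =
      X ^ p - C (z ^ p) := by
  have hζ := Complex.isPrimitiveRoot_exp p hp
  rw [X_pow_sub_C_eq_prod hζ (Nat.pos_of_ne_zero hp) rfl]
  refine Finset.prod_congr rfl fun k _ => ?_
  rw [← Complex.exp_nat_mul]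
  congr 5
  ring

theorem expNegDPow_eq_prod {p q r : ℕ} (hp : 1 ≤ p) (hr : r < p) {ρ : Fin q → ℝ}
    (hρ : Function.Injective ρ) (hz : ∀ j, ρ j ∈ positiveZeros (expNegDPow p (p * q + r))) :
    expNegDPow p (p * q + r) = X ^ r * ∏ j : Fin q, (X ^ p - C ((ρ j : ℂ) ^ p)) := by
  have hinj : Function.Injective fun j => ρ j ^ p := fun i j h =>
    hρ ((pow_left_inj₀ (hz i).1.le (hz j).1.le (by omega)).1 h)
  have hG := (roots_eq_val_of_card (monic_reducedPoly p q r).ne_zero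
    (natDegree_reducedPoly_le p q r) (S := Finset.univ.image fun j => ρ j ^ p)
    (by rw [Finset.card_image_of_injective _ hinj, Finset.card_univ, Fintype.card_fin])
    fun x hx => by
      obtain ⟨j, -, rfl⟩ := Finset.mem_image.1 hx
      exact ((mem_positiveZeros_expNegDPow hp hr _).1 (hz j)).2).2
  rw [(monic_reducedPoly p q r).leadingCoeff, C_1, one_mul,
    Finset.prod_image fun i _ j _ h => hinj h] at hG
  rw [expNegDPow_eq_expand hp hr, hG, Polynomial.map_prod, map_prod]
  simp

theorem theorem2p2 (d p q r : ℕ) (hd : 0 < d) (hp : 2 ≤ p)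
    (hq : q = d / p) (hr : r = d - p * q) :
    (q = 0 → expNegDPow p d = X ^ d) ∧
    (1 ≤ q →
      (positiveZeros (expNegDPow p d)).encard = q ∧
      ∀ ρ : Fin q → ℝ, Function.Injective ρ →
        Set.range ρ = positiveZeros (expNegDPow p d) →
        expNegDPow p d =
          X ^ r * ∏ j : Fin q, ∏ k ∈ Finset.range p,
            (X - C (Complex.exp (2 * (k : ℂ) * (Real.pi : ℂ) * Complex.I / (p : ℂ)) * (ρ j : ℂ)))) := by
  have hp1 : 1 ≤ p := by omega
  have hd' : d = p * q + r := by
    have := Nat.mul_div_le d p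
    rw [← hq] at this
    omega
  have hrp : r < p := by
    have h1 := Nat.div_add_mod d p
    have h2 := Nat.mod_lt d hp1
    rw [← hq] at h1
    omega
  clear hr hq hd
  subst hd'
  refine ⟨?_, fun _ => ⟨encard_positiveZeros_expNegDPow hp hrp, fun ρ hρ hrange => ?_⟩⟩
  · rintro rfl
    rw [expNegDPow_eq_sum hp1 hrp]
    simp
  · simp only [prod_X_sub_C_exp_mul (by omega : p ≠ 0)]
    exact expNegDPow_eq_prod hp1 hrp hρ fun j => hrange ▸ Set.mem_range_self j
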